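/- Let $\mathbb D=\{z\in\mathbb C:|z|<1\}$. Let $\psi$ be analytic and univalent in $\mathbb D$ with $\psi(0)=1$ and $\Re\psi(z)>0$ for $z\in\mathbb D$, and suppose that $\psi(\mathbb D)$ is starlike with respect to the point $1$. Let $\mathcal S^*(\psi)$ be the class of all analytic functions $f$ in $\mathbb D$ with $f(0)=0$, $f'(0)=1$ for which $\dfrac{zf'(z)}{f(z)}$ is subordinate to $\psi$; that is, $f$ has no zeros in $\mathbb D\setminus\{0\}$ and there is an analytic $w:\mathbb D\to\mathbb D$ with $w(0)=0$ such that $\dfrac{zf'(z)}{f(z)}=\psi(w(z))$ in $\mathbb D$ (the quotient taking the value $1$ at $z=0$). For $f\in\mathcal S^*(\psi)$ let $\log\dfrac{f(z)}{z}$ denote the analytic branch in $\mathbb D$ that vanishes at $z=0$. Suppose that $\Phi$ is a non-constant entire function, that $0<|z_0|<1$, and that $\mathcal S^*(\psi)$ is closed with respect to locally uniform convergence in $\mathbb D$. Then each of the two functionals $$f\mapsto\Re\,\Phi\!\left(\log\frac{f(z_0)}{z_0}\right)\qquad\text{and}\qquad f\mapsto\left|\Phi\!\left(\log\frac{f(z_0)}{z_0}\right)\right|$$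 has a maximum over $\mathcal S^*(\psi)$, and each of these maxima is attained only at functions of the form $$f(z)=z\exp\int_0^{\zeta z}\frac{\psi(t)-1}{t}\,dt\quad(z\in\mathbb D),\qquad |\zeta|=1 .$$ -/

import Mathlib

open Complex Set Filter Topology

noncomputable section

namespace MaMinda

/-- The open unit disk in the complex plane. -/
def disk : Set ℂ := Metric.ball 0 1

/-- The class of functions analytic in the unit disk with `f 0 = 0` and `f' 0 = 1`.
Functions are total on `ℂ`; only their values on the disk matter. -/
structure IsNormalized (f : ℂ → ℂ) : Prop where
  analytic : DifferentiableOn ℂ f disk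
  map_zero : f 0 = 0
  deriv_zero : deriv f 0 = 1

/-- `g` is subordinate to `h` in the unit disk: `g = h ∘ w` for some analytic
self-map `w` of the disk fixing the origin. -/
def Subordinate (g h : ℂ → ℂ) : Prop :=
  ∃ w : ℂ → ℂ, DifferentiableOn ℂ w disk ∧ MapsTo w disk disk ∧ w 0 = 0 ∧
    ∀ z ∈ disk, g z = h (w z)

/-- Ma–Minda functions: analytic and univalent in the disk, `ψ 0 = 1`, with positive real part
and with image starlike with respect to `1`. -/
structure IsMaMinda (ψ : ℂ → ℂ) : Prop where
  analytic : DifferentiableOn ℂ ψ disk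
  map_zero : ψ 0 = 1
  re_pos : ∀ z ∈ disk, 0 < (ψ z).re
  univalent : InjOn ψ disk
  starlike : StarConvex ℝ 1 (ψ '' disk)

/-- The quotient `z f'(z) / f(z)`, with its removable singularity at the origin filled in
(for normalized `f` the value there is `1`). -/
def starQuot (f : ℂ → ℂ) (z : ℂ) : ℂ := if z = 0 then 1 else z * deriv f z / f z

/-- The class of normalized analytic `f` without zeros in the punctured disk for which
`z f'(z) / f(z)` is subordinate to `ψ`. -/
def starClass (ψ : ℂ → ℂ) : Set (ℂ → ℂ) :=
  {f | IsNormalized f ∧ (∀ z ∈ disk, z ≠ 0 → f z ≠ 0) ∧ Subordinate (starQuot f) ψ}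

/-- A family of functions on the disk is closed for locally uniform convergence in the disk
(a metrizable topology, so sequences suffice). -/
def ClosedOnDisk (F : Set (ℂ → ℂ)) : Prop :=
  ∀ (u : ℕ → ℂ → ℂ) (f : ℂ → ℂ), (∀ n, u n ∈ F) →
    TendstoLocallyUniformlyOn u f atTop disk → f ∈ F

/-- `L` is the analytic branch of `log (f z / z)` in the disk that vanishes at the origin. -/
structure IsLogRatio (f L : ℂ → ℂ) : Prop where
  analytic : DifferentiableOn ℂ L disk
  map_zero : L 0 = 0
  eq_exp : ∀ z ∈ disk, f z = z * exp (L z)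

open Classical in
/-- The analytic branch of `log (f z / z)` in the disk that vanishes at the origin
(`0` if there is none). -/
def logRatio (f : ℂ → ℂ) : ℂ → ℂ :=
  if h : ∃ L, IsLogRatio f L then h.choose else 0

/-- The integral of `g` from `0` to `b` along the straight segment. -/
def segIntegral (g : ℂ → ℂ) (b : ℂ) : ℂ := ∫ s in (0 : ℝ)..1, g (s * b) * b

/-- The function `z ↦ z exp ∫₀^{ζ z} (ψ t - 1) / t dt`. -/
def extremal (ψ : ℂ → ℂ) (ζ z : ℂ) : ℂ :=
  z * exp (segIntegral (fun t => (ψ t - 1) / t) (ζ * z))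

/-- Existence of the branch for functions without zeros in the punctured disk. -/
theorem exists_isLogRatio {f : ℂ → ℂ} (hf : IsNormalized f)
    (h0 : ∀ z ∈ disk, z ≠ 0 → f z ≠ 0) : ∃ L, IsLogRatio f L := by
  have ho : IsOpen disk := Metric.isOpen_ball
  have hc : (0 : ℂ) ∈ disk := Metric.mem_ball_self one_pos
  have hg : DifferentiableOn ℂ (dslope f 0) disk :=
    (differentiableOn_dslope (ho.mem_nhds hc)).2 hf.analytic
  have hg0 : dslope f 0 0 = 1 := by rw [dslope_same, hf.deriv_zero]
  have hfg : ∀ z, f z = z * dslope f 0 z := by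
    intro z
    have h := sub_smul_dslope f 0 z
    rw [hf.map_zero, sub_zero, sub_zero, smul_eq_mul] at h
    exact h.symm
  have hgne : ∀ z ∈ disk, dslope f 0 z ≠ 0 := by
    intro z hz h
    by_cases hz0 : z = 0
    · rw [hz0, hg0] at h
      exact one_ne_zero h
    · exact h0 z hz hz0 (by rw [hfg, h, mul_zero])
  have hq : DifferentiableOn ℂ (fun z => deriv (dslope f 0) z / dslope f 0 z) disk :=
    (hg.deriv ho).div hg hgne
  obtain ⟨L, hL0, hL⟩ := hq.isExactOn_ball.with_val_at 0 0
  have hLd : DifferentiableOn ℂ L disk :=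
    fun z hz => (hL z hz).differentiableAt.differentiableWithinAt
  refine ⟨L, hLd, hL0, fun z hz => ?_⟩
  have key : ∀ w ∈ disk, HasDerivAt (fun z => dslope f 0 z * exp (-L z)) 0 w := by
    intro w hw
    have h1 := ((hg w hw).differentiableAt (ho.mem_nhds hw)).hasDerivAt
    have h2 := h1.mul (hL w hw).neg.cexp
    have h3 : deriv (dslope f 0) w * exp (-L w) + dslope f 0 w *
        (exp (-L w) * -(deriv (dslope f 0) w / dslope f 0 w)) = 0 := by
      have h5 : dslope f 0 w * (deriv (dslope f 0) w / dslope f 0 w) =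
        deriv (dslope f 0) w := mul_div_cancel₀ _ (hgne w hw)
      linear_combination -exp (-L w) * h5
    exact h2.congr_deriv h3
  have hconst := ho.is_const_of_deriv_eq_zero (convex_ball (0 : ℂ) 1).isPreconnected
    (fun w hw => (key w hw).differentiableAt.differentiableWithinAt)
    (fun w hw => (key w hw).deriv) hz hc
  simp only [hg0, hL0, neg_zero, Complex.exp_zero, mul_one] at hconst
  rw [hfg z]
  congr 1
  rw [Complex.exp_neg] at hconst
  exact (mul_inv_eq_one₀ (Complex.exp_ne_zero _)).1 hconst

/-- Uniqueness of the branch. -/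
theorem IsLogRatio.eqOn {f L M : ℂ → ℂ} (hL : IsLogRatio f L) (hM : IsLogRatio f M) :
    EqOn L M disk := by
  have ho : IsOpen disk := Metric.isOpen_ball
  have hc : (0 : ℂ) ∈ disk := Metric.mem_ball_self one_pos
  have he : EqOn (fun z => exp (L z)) (fun z => exp (M z)) disk := by
    intro z hz
    by_cases hz0 : z = 0
    · simp [hz0, hL.map_zero, hM.map_zero]
    · exact mul_left_cancel₀ hz0 ((hL.eq_exp z hz).symm.trans (hM.eq_exp z hz))
  refine ho.eqOn_of_deriv_eq (convex_ball (0 : ℂ) 1).isPreconnected hL.analytic hM.analytic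
    (fun z hz => ?_) hc (by rw [hL.map_zero, hM.map_zero])
  have h1 := ((hL.analytic z hz).differentiableAt (ho.mem_nhds hz)).hasDerivAt.cexp.deriv
  have h2 := ((hM.analytic z hz).differentiableAt (ho.mem_nhds hz)).hasDerivAt.cexp.deriv
  have h3 := (he.eventuallyEq_of_mem (ho.mem_nhds hz)).deriv_eq
  rw [h1, h2, show exp (L z) = exp (M z) from he hz] at h3
  exact mul_left_cancel₀ (Complex.exp_ne_zero _) h3

/-- On the class the function `logRatio f` is the branch it is meant to be. -/
theorem isLogRatio_logRatio {ψ f : ℂ → ℂ} (hf : f ∈ starClass ψ) :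
    IsLogRatio f (logRatio f) := by
  have h := exists_isLogRatio hf.1 hf.2.1
  rw [logRatio, dif_pos h]
  exact h.choose_spec

end MaMinda

end

noncomputable section

namespace MaMinda

/-! Put `p = ψ - 1` and let `K` be the primitive with `z K' = p`, `K 0 = 0`, so that the extremal
functions are `z exp (K (ζ z))`. For `f` in the class, `L = log (f z / z)` satisfies `z L' = p ∘ w`
with `w` a Schwarz function. The core is that `L` is subordinate to the univalent function `K`
(`IsStarlike.exists_schwarz`): `L = K ∘ ω`.

Given this, the values of `L z₀` lie in `K` of the closed disk of radius `‖z₀‖`, and rotations reach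
every boundary value. The maximum principle for `Φ ∘ K` puts all maxima of the modulus on the
circle; there `‖ω z₀‖ = ‖z₀‖`, and the equality case of the Schwarz lemma makes `ω` a rotation. The
real part reduces to the modulus of `exp ∘ Φ`.

Subordination rests on a supporting line: for `‖z‖ ≤ ‖ζ‖`, `Re (conj (p ζ) * L z)` is at most `Re
(conj (p ζ) * K ζ)` (`IsStarlike.re_conj_mul_le`), strictly if `L = K` and `z ≠ ζ`
(`IsStarlike.re_conj_mul_lt`). Starlikeness of `p` enters through the paths `s ↦ p⁻¹ (s * p ζ)`,
along which the modulus increases. -/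

theorem isOpen_disk : IsOpen disk := Metric.isOpen_ball

theorem mem_disk {z : ℂ} : z ∈ disk ↔ ‖z‖ < 1 := mem_ball_zero_iff

theorem zero_mem_disk : (0 : ℂ) ∈ disk := Metric.mem_ball_self one_pos

/-! ### Univalent functions and their inverses. -/

theorem deriv_eventually_ne_zero_of_injOn {g : ℂ → ℂ} {U : Set ℂ} (hU : IsOpen U)
    (hg : DifferentiableOn ℂ g U) (hinj : InjOn g U) {a : ℂ} (ha : a ∈ U) :
    ∀ᶠ x in 𝓝[≠] a, deriv g x ≠ 0 := by
  have hda : AnalyticAt ℂ (deriv g) a := (hg.analyticAt (hU.mem_nhds ha)).deriv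
  rcases hda.eventually_eq_zero_or_eventually_ne_zero with h | h
  · exfalso
    obtain ⟨r, hr, hball⟩ := Metric.mem_nhds_iff.1 (h.and (hU.mem_nhds ha))
    have hconst : ∀ x ∈ Metric.ball a r, g x = g a := fun x hx =>
      Metric.isOpen_ball.is_const_of_deriv_eq_zero (convex_ball a r).isPreconnected
        (hg.mono fun y hy => (hball hy).2) (fun y hy => (hball hy).1) hx (Metric.mem_ball_self hr)
    have hx : a + (r / 2 : ℝ) ∈ Metric.ball a r := by
      rw [mem_ball_iff_norm, add_sub_cancel_left, Complex.norm_real, Real.norm_eq_abs,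
        abs_of_pos (by positivity)]
      linarith
    have h1 := hinj (hball hx).2 ha (hconst _ hx)
    have h2 : ((r / 2 : ℝ) : ℂ) = 0 := by simpa using h1
    rw [Complex.ofReal_eq_zero] at h2
    linarith
  · exact h

theorem nhds_le_map_of_injOn {g : ℂ → ℂ} {U : Set ℂ} (hU : IsOpen U)
    (hg : DifferentiableOn ℂ g U) (hinj : InjOn g U) {a : ℂ} (ha : a ∈ U) :
    𝓝 (g a) ≤ map g (𝓝 a) := by
  rcases (hg.analyticAt (hU.mem_nhds ha)).eventually_constant_or_nhds_le_map_nhds_aux with h | h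
  · have h1 : ∀ᶠ x in 𝓝[≠] a, x = a := by
      filter_upwards [nhdsWithin_le_nhds h, nhdsWithin_le_nhds (hU.mem_nhds ha)] with x hx hxU
      exact hinj hxU ha hx
    obtain ⟨x, hx, hxa⟩ := (h1.and self_mem_nhdsWithin).exists
    exact absurd hx hxa
  · exact h

theorem invFunOn_apply {g : ℂ → ℂ} {U : Set ℂ} (hinj : InjOn g U) {a : ℂ} (ha : a ∈ U) :
    Function.invFunOn g U (g a) = a :=
  hinj.leftInvOn_invFunOn ha

theorem continuousAt_invFunOn {g : ℂ → ℂ} {U : Set ℂ} (hU : IsOpen U)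
    (hg : DifferentiableOn ℂ g U) (hinj : InjOn g U) {a : ℂ} (ha : a ∈ U) :
    ContinuousAt (Function.invFunOn g U) (g a) := by
  rw [ContinuousAt, invFunOn_apply hinj ha]
  refine Tendsto.mono_left ?_ (nhds_le_map_of_injOn hU hg hinj ha)
  rw [tendsto_map'_iff]
  refine tendsto_id.congr' ?_
  filter_upwards [hU.mem_nhds ha] with x hx
  exact (invFunOn_apply hinj hx).symm

theorem hasDerivAt_invFunOn_of_ne_zero {g : ℂ → ℂ} {U : Set ℂ} (hU : IsOpen U)
    (hg : DifferentiableOn ℂ g U) (hinj : InjOn g U) {a : ℂ} (ha : a ∈ U)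
    (hne : deriv g a ≠ 0) :
    HasDerivAt (Function.invFunOn g U) (deriv g a)⁻¹ (g a) := by
  have h1 : HasStrictDerivAt g (deriv g a) a :=
    (hg.analyticAt (hU.mem_nhds ha)).hasStrictDerivAt
  refine (h1.to_local_left_inverse hne ?_).hasDerivAt
  filter_upwards [hU.mem_nhds ha] with x hx
  exact invFunOn_apply hinj hx

/-- The critical points of `g` are isolated, so the inverse is differentiable on a punctured
neighbourhood of `g a` and continuous at `g a`. The singularity is therefore removable, and the
chain rule for `g⁻¹ ∘ g = id` excludes a zero derivative. -/
theorem deriv_ne_zero_of_injOn {g : ℂ → ℂ} {U : Set ℂ} (hU : IsOpen U)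
    (hg : DifferentiableOn ℂ g U) (hinj : InjOn g U) {a : ℂ} (ha : a ∈ U) : deriv g a ≠ 0 := by
  have hcont := continuousAt_invFunOn hU hg hinj ha
  have hd : ∀ᶠ y in 𝓝[≠] (g a), DifferentiableAt ℂ (Function.invFunOn g U) y := by
    have h1 := eventually_nhdsWithin_iff.1 (deriv_eventually_ne_zero_of_injOn hU hg hinj ha)
    have h2 : ∀ᶠ y in map g (𝓝 a), y ≠ g a → DifferentiableAt ℂ (Function.invFunOn g U) y := by
      rw [eventually_map]
      filter_upwards [h1, hU.mem_nhds ha] with x hx hxU hxa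
      exact (hasDerivAt_invFunOn_of_ne_zero hU hg hinj hxU
        (hx fun h => hxa (by rw [mem_singleton_iff.1 h]))).differentiableAt
    exact eventually_nhdsWithin_iff.2 (nhds_le_map_of_injOn hU hg hinj ha h2)
  have hinv := (analyticAt_of_differentiable_on_punctured_nhds_of_continuousAt hd
    hcont).differentiableAt.hasDerivAt
  have hga := ((hg a ha).differentiableAt (hU.mem_nhds ha)).hasDerivAt
  have hcomp := hinv.comp a hga
  have hid : HasDerivAt (Function.invFunOn g U ∘ g) 1 a := by
    refine (hasDerivAt_id a).congr_of_eventuallyEq ?_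
    filter_upwards [hU.mem_nhds ha] with x hx
    exact invFunOn_apply hinj hx
  intro h0
  have := hcomp.unique hid
  rw [h0, mul_zero] at this
  exact zero_ne_one this

/-- The inverse function theorem for univalent functions. -/
theorem hasDerivAt_invFunOn {g : ℂ → ℂ} {U : Set ℂ} (hU : IsOpen U)
    (hg : DifferentiableOn ℂ g U) (hinj : InjOn g U) {a : ℂ} (ha : a ∈ U) :
    HasDerivAt (Function.invFunOn g U) (deriv g a)⁻¹ (g a) :=
  hasDerivAt_invFunOn_of_ne_zero hU hg hinj ha (deriv_ne_zero_of_injOn hU hg hinj ha)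

/-! ### The Schwarz lemma and its equality case. -/

/-- Analytic self-maps of the disk that fix the origin. -/
structure IsSchwarz (w : ℂ → ℂ) : Prop where
  analytic : DifferentiableOn ℂ w disk
  mapsTo : MapsTo w disk disk
  map_zero : w 0 = 0

theorem IsSchwarz.norm_le {w : ℂ → ℂ} (hw : IsSchwarz w) {z : ℂ} (hz : z ∈ disk) :
    ‖w z‖ ≤ ‖z‖ :=
  Complex.norm_le_norm_of_mapsTo_ball hw.analytic
    (fun _ hx => Metric.ball_subset_closedBall (hw.mapsTo hx)) hw.map_zero (mem_disk.1 hz)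

theorem IsSchwarz.exists_rotation {w : ℂ → ℂ} (hw : IsSchwarz w) {z : ℂ} (hz : z ∈ disk)
    (hz0 : z ≠ 0) (h : ‖w z‖ = ‖z‖) : ∃ η : ℂ, ‖η‖ = 1 ∧ ∀ x ∈ disk, w x = η * x := by
  have h1 : ‖dslope w 0 z‖ = 1 / 1 := by
    rw [dslope_of_ne _ hz0, slope_def_field, hw.map_zero, sub_zero, sub_zero, norm_div, h,
      div_self (norm_ne_zero_iff.2 hz0), div_one]
  refine ⟨dslope w 0 z, by rw [h1, div_one], fun x hx => ?_⟩
  have h2 := Complex.affine_of_mapsTo_ball_of_norm_dslope_eq_div hw.analytic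
    (by rw [hw.map_zero]; exact fun _ hx => Metric.ball_subset_closedBall (hw.mapsTo hx)) hz h1 hx
  rw [h2]
  simp only [hw.map_zero, zero_add, sub_zero, smul_eq_mul]
  exact mul_comm _ _

theorem isSchwarz_mul {η : ℂ} (hη : ‖η‖ ≤ 1) : IsSchwarz (fun z => η * z) where
  analytic := (differentiable_id.const_mul η).differentiableOn
  mapsTo := fun z hz => by
    rw [mem_disk] at hz ⊢
    rw [norm_mul]
    nlinarith [norm_nonneg z]
  map_zero := mul_zero η

/-! ### Starlike functions and radial contraction of their image. -/

/-- Univalent functions on the disk that map it onto a domain starlike about `0 = p 0`. -/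
structure IsStarlike (p : ℂ → ℂ) : Prop where
  analytic : DifferentiableOn ℂ p disk
  map_zero : p 0 = 0
  univalent : InjOn p disk
  starlike : ∀ z ∈ disk, ∀ s ∈ Icc (0 : ℝ) 1, ∃ y ∈ disk, p y = s * p z

theorem IsMaMinda.isStarlike {ψ : ℂ → ℂ} (hψ : IsMaMinda ψ) :
    IsStarlike (fun z => ψ z - 1) where
  analytic := hψ.analytic.sub_const 1
  map_zero := by simp [hψ.map_zero]
  univalent := fun x hx y hy h => hψ.univalent hx hy (sub_left_injective h)
  starlike := fun z hz s hs => by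
    obtain ⟨y, hy, h⟩ := hψ.starlike (mem_image_of_mem ψ hz) (sub_nonneg.2 hs.2) hs.1
      (sub_add_cancel 1 s)
    refine ⟨y, hy, ?_⟩
    simp only [h, Complex.real_smul, Complex.ofReal_sub, Complex.ofReal_one]
    ring

namespace IsStarlike

variable {p : ℂ → ℂ}

theorem eq_zero (hp : IsStarlike p) {z : ℂ} (hz : z ∈ disk) (h : p z = 0) : z = 0 :=
  hp.univalent hz zero_mem_disk (by rw [h, hp.map_zero])

/-- The point of the disk that `p` maps to `s * p z`. -/
def contract (p : ℂ → ℂ) (s : ℝ) (z : ℂ) : ℂ := Function.invFunOn p disk (s * p z)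

theorem contract_mem (hp : IsStarlike p) {s : ℝ} (hs : s ∈ Icc (0 : ℝ) 1) {z : ℂ}
    (hz : z ∈ disk) : contract p s z ∈ disk :=
  Function.invFunOn_mem (by simpa using hp.starlike z hz s hs)

theorem map_contract (hp : IsStarlike p) {s : ℝ} (hs : s ∈ Icc (0 : ℝ) 1) {z : ℂ}
    (hz : z ∈ disk) : p (contract p s z) = s * p z :=
  Function.invFunOn_eq (by simpa using hp.starlike z hz s hs)

theorem contract_eq (hp : IsStarlike p) {s : ℝ} {y z : ℂ} (hy : y ∈ disk)
    (h : p y = s * p z) : contract p s z = y := by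
  rw [contract, ← h, invFunOn_apply hp.univalent hy]

theorem isSchwarz_contract (hp : IsStarlike p) {s : ℝ} (hs : s ∈ Icc (0 : ℝ) 1) :
    IsSchwarz (contract p s) where
  analytic := fun z hz => by
    have h1 := hasDerivAt_invFunOn isOpen_disk hp.analytic hp.univalent (hp.contract_mem hs hz)
    rw [hp.map_contract hs hz] at h1
    have h2 := ((hp.analytic z hz).differentiableAt (isOpen_disk.mem_nhds hz)).hasDerivAt
    exact (h1.comp z (h2.const_mul (s : ℂ))).differentiableAt.differentiableWithinAt
  mapsTo := fun _ hz => hp.contract_mem hs hz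
  map_zero := hp.contract_eq zero_mem_disk (by simp [hp.map_zero])

/-- The contraction `p⁻¹ (s * p z)` is a Schwarz function of `z`. -/
theorem norm_le_of_eq_mul (hp : IsStarlike p) {s : ℝ} (hs : s ∈ Icc (0 : ℝ) 1) {y z : ℂ}
    (hy : y ∈ disk) (hz : z ∈ disk) (h : p y = s * p z) : ‖y‖ ≤ ‖z‖ := by
  rw [← hp.contract_eq hy h]
  exact (hp.isSchwarz_contract hs).norm_le hz

/-- Equality would make the contraction a rotation by some `η`; comparing derivatives at the origin
in `p (η x) = s * p x` gives `η = s`, which is not unimodular. -/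
theorem norm_lt_of_eq_mul (hp : IsStarlike p) {s : ℝ} (hs : s ∈ Ico (0 : ℝ) 1) {y z : ℂ}
    (hy : y ∈ disk) (hz : z ∈ disk) (hz0 : z ≠ 0) (h : p y = s * p z) : ‖y‖ < ‖z‖ := by
  have hs' : s ∈ Icc (0 : ℝ) 1 := ⟨hs.1, hs.2.le⟩
  refine lt_of_le_of_ne (hp.norm_le_of_eq_mul hs' hy hz h) fun heq => ?_
  rw [← hp.contract_eq hy h] at heq
  obtain ⟨η, hη, hrot⟩ := (hp.isSchwarz_contract hs').exists_rotation hz hz0 heq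
  have hp0 := ((hp.analytic 0 zero_mem_disk).differentiableAt
    (isOpen_disk.mem_nhds zero_mem_disk)).hasDerivAt
  have hne := deriv_ne_zero_of_injOn isOpen_disk hp.analytic hp.univalent zero_mem_disk
  have h1 : HasDerivAt (fun x => p (η * x)) (deriv p 0 * (η * 1)) 0 :=
    HasDerivAt.comp (0 : ℂ) (by rw [mul_zero]; exact hp0) ((hasDerivAt_id (0 : ℂ)).const_mul η)
  have h2 : HasDerivAt (fun x => p (η * x)) (s * deriv p 0) 0 := by
    refine (hp0.const_mul (s : ℂ)).congr_of_eventuallyEq ?_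
    filter_upwards [isOpen_disk.mem_nhds zero_mem_disk] with x hx
    rw [← hrot x hx, hp.map_contract hs' hx]
  have h3 := h1.unique h2
  have h4 : η = s := mul_left_cancel₀ hne (by rw [← mul_one η, h3, mul_comm])
  rw [h4, Complex.norm_real, Real.norm_of_nonneg hs.1] at hη
  exact absurd hη hs.2.ne

theorem hasDerivAt_contract (hp : IsStarlike p) {s : ℝ} (hs : s ∈ Icc (0 : ℝ) 1) {z : ℂ}
    (hz : z ∈ disk) :
    HasDerivAt (fun t : ℝ => contract p t z) ((deriv p (contract p s z))⁻¹ * p z) s := by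
  have h1 := hasDerivAt_invFunOn isOpen_disk hp.analytic hp.univalent (hp.contract_mem hs hz)
  rw [hp.map_contract hs hz] at h1
  have h2 : HasDerivAt (fun t : ℝ => (t : ℂ) * p z) (p z) s := by
    simpa using (hasDerivAt_id s).ofReal_comp.mul_const (p z)
  exact h1.comp s h2

theorem norm_contract_mono (hp : IsStarlike p) {s t : ℝ} (hs : 0 ≤ s) (hst : s ≤ t) (ht : t ≤ 1)
    {z : ℂ} (hz : z ∈ disk) : ‖contract p s z‖ ≤ ‖contract p t z‖ := by
  rcases hs.eq_or_lt with rfl | hs0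
  · rw [hp.contract_eq zero_mem_disk (by simp [hp.map_zero]), norm_zero]
    exact norm_nonneg _
  · have ht0 : 0 < t := hs0.trans_le hst
    refine hp.norm_le_of_eq_mul (s := s / t) ⟨by positivity, (div_le_one ht0).2 hst⟩
      (hp.contract_mem ⟨hs, hst.trans ht⟩ hz) (hp.contract_mem ⟨ht0.le, ht⟩ hz) ?_
    rw [hp.map_contract ⟨hs, hst.trans ht⟩ hz, hp.map_contract ⟨ht0.le, ht⟩ hz, ← mul_assoc,
      ← Complex.ofReal_mul, div_mul_cancel₀ _ ht0.ne']

end IsStarlike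

/-! ### The supporting-line inequality. -/

theorem nonneg_of_hasDerivAt_of_le {u : ℝ → ℝ} {u' s a : ℝ} (hu : HasDerivAt u u' s)
    (has : a < s) (h : ∀ t ∈ Ioo a s, u t ≤ u s) : 0 ≤ u' := by
  have h1 := (hasDerivAt_iff_tendsto_slope.1 hu).mono_left
    (nhdsWithin_mono s (show Iio s ⊆ {s}ᶜ from fun x hx => ne_of_lt hx))
  refine ge_of_tendsto h1 ?_
  filter_upwards [Ioo_mem_nhdsLT has] with t ht
  rw [slope_def_field]
  exact div_nonneg_of_nonpos (sub_nonpos.2 (h t ht)) (sub_nonpos.2 ht.2.le)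

/-- With `q s` the contracted point, `Re (q' / q)` is the logarithmic derivative of `‖q‖`, and `‖q
s‖` is nondecreasing in `s`. At `z = 0` the quotient is `0` by convention. -/
theorem IsStarlike.re_div_nonneg {p : ℂ → ℂ} (hp : IsStarlike p) {s : ℝ} (hs : s ∈ Ioc (0 : ℝ) 1)
    {z : ℂ} (hz : z ∈ disk) :
    0 ≤ ((deriv p (contract p s z))⁻¹ * p z / contract p s z).re := by
  have h1 := (hp.hasDerivAt_contract ⟨hs.1.le, hs.2⟩ hz).norm_sq
  have h2 := nonneg_of_hasDerivAt_of_le h1 hs.1 fun t ht => by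
    have := hp.norm_contract_mono ht.1.le ht.2.le hs.2 hz
    gcongr
  have h3 : 0 ≤ inner ℝ (contract p s z) ((deriv p (contract p s z))⁻¹ * p z) := by linarith
  rw [Complex.inner] at h3
  set q := contract p s z
  set q' := (deriv p q)⁻¹ * p z
  have h4 : (q' / q).re = ((starRingEnd ℂ) q * q').re / normSq q := by
    rw [div_eq_mul_inv, Complex.inv_def, ← mul_assoc, Complex.re_mul_ofReal, mul_comm q', div_eq_mul_inv]
  rw [h4]
  exact div_nonneg (by rw [mul_comm]; exact h3) (normSq_nonneg q)

/-- `L` vanishes at the origin and `z * L' z = p (w z)` in the disk, with `w` a Schwarz function. -/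
structure IsEulerPrimitive (p w L : ℂ → ℂ) : Prop where
  schwarz : IsSchwarz w
  analytic : DifferentiableOn ℂ L disk
  map_zero : L 0 = 0
  mul_deriv : ∀ z ∈ disk, z * deriv L z = p (w z)

theorem IsEulerPrimitive.hasDerivAt {p w L : ℂ → ℂ} (hL : IsEulerPrimitive p w L) {z : ℂ}
    (hz : z ∈ disk) : HasDerivAt L (deriv L z) z :=
  ((hL.analytic z hz).differentiableAt (isOpen_disk.mem_nhds hz)).hasDerivAt

theorem hasDerivAt_re {f : ℝ → ℂ} {f' : ℂ} {t : ℝ} (h : HasDerivAt f f' t) :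
    HasDerivAt (fun t => (f t).re) f'.re t :=
  reCLM.hasFDerivAt.comp_hasDerivAt t h

/-- The derivative of `c * G (z e^{it})` at `t = 0` is `i c z G'`, whose real part vanishes at a
maximum. -/
theorem im_eq_zero_of_isMax_circle {G : ℂ → ℂ} {G' z c : ℂ} (hG : HasDerivAt G G' z)
    (h : ∀ t : ℝ, (c * G (z * exp (t * I))).re ≤ (c * G z).re) : (c * (z * G')).im = 0 := by
  have h1 : HasDerivAt (fun t : ℝ => z * exp (t * I)) (z * I) 0 := by
    have := (((hasDerivAt_id (0 : ℝ)).ofReal_comp.mul_const I).cexp).const_mul z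
    simpa using this
  have hG' : HasDerivAt G G' (z * exp (((0 : ℝ) : ℂ) * I)) := by simpa using hG
  have h2 := hasDerivAt_re ((hG'.comp (0 : ℝ) h1).const_mul c)
  have hmax : IsLocalMax (fun t : ℝ => (c * G (z * exp (t * I))).re) 0 :=
    Eventually.of_forall fun t => by simpa using h t
  have h3 := hmax.hasDerivAt_eq_zero h2
  have h4 : c * (G' * (z * I)) = c * (z * G') * I := by ring
  rw [h4, mul_I_re, neg_eq_zero] at h3
  exact h3

/-- A maximum argument in two variables: the rotation or shrinking factor `η`, and the parameter `s`
of the path `q` from `0` to `ζ` on which `p` is radial. The functional stays fixed along the path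
because `p (q s)` keeps its direction. -/
theorem IsStarlike.re_conj_mul_le {p w K L : ℂ → ℂ} (hp : IsStarlike p)
    (hK : IsEulerPrimitive p id K) (hL : IsEulerPrimitive p w L) {ζ η : ℂ} (hζ : ζ ∈ disk)
    (hη : ‖η‖ ≤ 1) :
    ((starRingEnd ℂ) (p ζ) * L (η * ζ)).re ≤ ((starRingEnd ℂ) (p ζ) * K ζ).re := by
  rcases eq_or_ne ζ 0 with rfl | hζ0
  · simp [hp.map_zero]
  set c := p ζ with hc
  have hc0 : c ≠ 0 := fun h => hζ0 (hp.eq_zero hζ h)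
  have hcc : 0 < normSq c := normSq_pos.2 hc0
  set q : ℝ → ℂ := fun s => IsStarlike.contract p s ζ with hq
  have hq1 : q 1 = ζ := hp.contract_eq hζ (by simp)
  have hq0 : q 0 = 0 := hp.contract_eq zero_mem_disk (by simp [hp.map_zero])
  have hqmem : ∀ s ∈ Icc (0 : ℝ) 1, q s ∈ disk := fun s hs => hp.contract_mem hs hζ
  have hpq : ∀ s ∈ Icc (0 : ℝ) 1, p (q s) = s * c := fun s hs => hp.map_contract hs hζ
  have hqcont : ContinuousOn q (Icc 0 1) := fun s hs =>
    (hp.hasDerivAt_contract hs hζ).continuousAt.continuousWithinAt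
  have hmem : ∀ x ∈ Metric.closedBall (0 : ℂ) 1 ×ˢ Icc (0 : ℝ) 1, x.1 * q x.2 ∈ disk :=
    fun x hx => (isSchwarz_mul (mem_closedBall_zero_iff.1 hx.1)).mapsTo (hqmem _ hx.2)
  -- The penalty `ε * s` turns the weak monotonicity of `‖q s‖` into a strict contradiction at a
  -- maximum with `s > 0`.
  refine le_of_forall_pos_le_add fun ε hε => ?_
  set F : ℂ × ℝ → ℝ := fun x =>
    ((starRingEnd ℂ) c * (L (x.1 * q x.2) - K (q x.2))).re - ε * x.2 with hF
  have hFcont : ContinuousOn F (Metric.closedBall (0 : ℂ) 1 ×ˢ Icc (0 : ℝ) 1) := by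
    have h1 : ContinuousOn (fun x : ℂ × ℝ => q x.2) (Metric.closedBall (0 : ℂ) 1 ×ˢ Icc (0 : ℝ) 1) :=
      hqcont.comp continuousOn_snd fun x hx => hx.2
    have h2 := hL.analytic.continuousOn.comp (continuousOn_fst.mul h1) hmem
    have h3 := hK.analytic.continuousOn.comp h1 fun x hx => hqmem _ hx.2
    exact (continuous_re.comp_continuousOn (continuousOn_const.mul (h2.sub h3))).sub
      (continuousOn_const.mul continuousOn_snd)
  obtain ⟨⟨η₁, s₁⟩, hx₁, hmax⟩ := ((isCompact_closedBall (0 : ℂ) 1).prod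
    (isCompact_Icc (a := (0 : ℝ)) (b := 1))).exists_isMaxOn
    ⟨(0, 0), by simp⟩ hFcont
  have hη₁ : ‖η₁‖ ≤ 1 := mem_closedBall_zero_iff.1 hx₁.1
  have hs₁ : s₁ ∈ Icc (0 : ℝ) 1 := hx₁.2
  have hF₁ : F (η₁, s₁) ≤ 0 := by
    rcases hs₁.1.eq_or_lt with h0 | hs0
    · rw [← h0]
      simp [hF, hq0, hL.map_zero, hK.map_zero]
    exfalso
    have hz₁ := hmem _ hx₁
    simp only at hz₁
    have hq₁0 : q s₁ ≠ 0 := by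
      intro h
      have := hpq s₁ hs₁
      rw [h, hp.map_zero] at this
      exact mul_ne_zero (Complex.ofReal_ne_zero.2 hs0.ne') hc0 this.symm
    -- Stationarity under rotation of `η₁` makes `p (w (η₁ * q s₁))` a real multiple of `c`.
    have him : ((starRingEnd ℂ) c * (η₁ * q s₁ * deriv L (η₁ * q s₁))).im = 0 := by
      refine im_eq_zero_of_isMax_circle (hL.hasDerivAt hz₁) fun t => ?_
      have hmem' : (η₁ * exp (t * I), s₁) ∈ Metric.closedBall (0 : ℂ) 1 ×ˢ Icc (0 : ℝ) 1 :=
        ⟨by simpa [norm_mul, Complex.norm_exp_ofReal_mul_I] using hη₁, hs₁⟩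
      have h1 : F (η₁ * exp (t * I), s₁) ≤ F (η₁, s₁) := hmax hmem'
      simp only [hF, mul_sub, sub_re] at h1
      have h2 : η₁ * q s₁ * exp (t * I) = η₁ * exp (t * I) * q s₁ := by ring
      rw [h2]
      linarith
    rw [hL.mul_deriv _ hz₁] at him
    set m := ((starRingEnd ℂ) c * p (w (η₁ * q s₁))).re with hm
    have hmeq : (starRingEnd ℂ) c * p (w (η₁ * q s₁)) = m := by
      apply Complex.ext <;> simp [hm, him]
    -- Otherwise `p (q s₁)` is a proper contraction of `p (w (η₁ * q s₁))`, so `‖q s₁‖ < ‖w (η₁ * q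
    -- s₁)‖`, against the Schwarz lemma for `w`.
    have hmle : m ≤ normSq c * s₁ := by
      by_contra! hlt
      have hmpos : 0 < m := lt_trans (by positivity) hlt
      have hw := hL.schwarz.mapsTo hz₁
      have hpw : (m : ℂ) * c = normSq c * p (w (η₁ * q s₁)) := by
        rw [← hmeq, normSq_eq_conj_mul_self]
        ring
      have hlt' : ‖q s₁‖ < ‖w (η₁ * q s₁)‖ := by
        refine hp.norm_lt_of_eq_mul (s := normSq c * s₁ / m)
          ⟨by positivity, (div_lt_one hmpos).2 hlt⟩ (hqmem _ hs₁) hw ?_ ?_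
        · intro h
          rw [h, hp.map_zero, mul_zero] at hpw
          exact mul_ne_zero (Complex.ofReal_ne_zero.2 hmpos.ne') hc0 hpw
        · rw [hpq _ hs₁]
          have hm0 : (m : ℂ) ≠ 0 := Complex.ofReal_ne_zero.2 hmpos.ne'
          push_cast
          field_simp
          linear_combination (s₁ : ℂ) * hpw
      have h2 := hL.schwarz.norm_le hz₁
      rw [norm_mul] at h2
      nlinarith [norm_nonneg (q s₁)]
    have hq' : HasDerivAt q ((deriv p (q s₁))⁻¹ * c) s₁ := hp.hasDerivAt_contract hs₁ hζ
    set q' := (deriv p (q s₁))⁻¹ * c with hq'def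
    have hre : 0 ≤ (q' / q s₁).re := hp.re_div_nonneg ⟨hs0, hs₁.2⟩ hζ
    have hd1 : HasDerivAt (fun s => L (η₁ * q s)) (deriv L (η₁ * q s₁) * (η₁ * q')) s₁ :=
      (hL.hasDerivAt hz₁).comp s₁ (hq'.const_mul η₁)
    have hd2 : HasDerivAt (fun s => K (q s)) (deriv K (q s₁) * q') s₁ :=
      (hK.hasDerivAt (hqmem _ hs₁)).comp s₁ hq'
    have hd := (hasDerivAt_re ((hd1.sub hd2).const_mul ((starRingEnd ℂ) c))).sub
      ((hasDerivAt_id s₁).const_mul ε)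
    -- Only smaller parameters are compared, since `s₁` may equal `1`. The resulting derivative is a
    -- nonpositive multiple of `Re (q' / q)`, minus `ε`, hence negative.
    have hpos := nonneg_of_hasDerivAt_of_le hd hs0 fun t ht => by
      have : (η₁, t) ∈ Metric.closedBall (0 : ℂ) 1 ×ˢ Icc (0 : ℝ) 1 :=
        ⟨hx₁.1, ht.1.le, ht.2.le.trans hs₁.2⟩
      exact hmax this
    have he : (starRingEnd ℂ) c * (deriv L (η₁ * q s₁) * (η₁ * q') - deriv K (q s₁) * q')
        = ((m - normSq c * s₁ : ℝ) : ℂ) * (q' / q s₁) := by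
      have e1 := hL.mul_deriv _ hz₁
      have e2 := hK.mul_deriv _ (hqmem _ hs₁)
      rw [id, hpq _ hs₁] at e2
      push_cast
      rw [← hmeq, normSq_eq_conj_mul_self, ← e1]
      field_simp
      linear_combination (-(starRingEnd ℂ) c * q') * e2
    rw [he, re_ofReal_mul] at hpos
    nlinarith
  have h1 : F (η, 1) ≤ F (η₁, s₁) := hmax (⟨mem_closedBall_zero_iff.2 hη, by simp⟩ :
    (η, (1 : ℝ)) ∈ Metric.closedBall (0 : ℂ) 1 ×ˢ Icc (0 : ℝ) 1)
  have h2 := h1.trans hF₁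
  simp only [hF, hq1, mul_sub, sub_re] at h2
  linarith

/-- `K'` is `p z / z` away from the origin and `p' 0` at the origin. -/
theorem IsStarlike.deriv_ne_zero {p K : ℂ → ℂ} (hp : IsStarlike p) (hK : IsEulerPrimitive p id K)
    {z : ℂ} (hz : z ∈ disk) : deriv K z ≠ 0 := by
  rcases eq_or_ne z 0 with rfl | hz0
  · have h1 : HasDerivAt (fun z => z * deriv K z) (deriv K 0) 0 := by
      have h2 := ((hK.analytic.deriv isOpen_disk 0 zero_mem_disk).differentiableAt
        (isOpen_disk.mem_nhds zero_mem_disk)).hasDerivAt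
      exact ((hasDerivAt_id (0 : ℂ)).mul h2).congr_deriv (by simp)
    have h3 : HasDerivAt p (deriv K 0) 0 := by
      refine h1.congr_of_eventuallyEq ?_
      filter_upwards [isOpen_disk.mem_nhds zero_mem_disk] with x hx
      exact (hK.mul_deriv x hx).symm
    rw [← h3.deriv]
    exact deriv_ne_zero_of_injOn isOpen_disk hp.analytic hp.univalent zero_mem_disk
  · intro h
    have h1 := hK.mul_deriv z hz
    rw [h, mul_zero] at h1
    exact hz0 (hp.eq_zero hz h1.symm)

/-- Each point of a circle is the only point of the closed disk at which some linear functional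
of `K` is maximal. -/
theorem IsStarlike.re_conj_mul_lt {p K : ℂ → ℂ} (hp : IsStarlike p)
    (hK : IsEulerPrimitive p id K) {z ζ : ℂ} (hζ : ζ ∈ disk) (hz : ‖z‖ ≤ ‖ζ‖) (hne : z ≠ ζ) :
    ((starRingEnd ℂ) (p ζ) * K z).re < ((starRingEnd ℂ) (p ζ) * K ζ).re := by
  have hζ0 : ζ ≠ 0 := by
    rintro rfl
    exact hne (norm_le_zero_iff.1 (by simpa using hz))
  have hzd : z ∈ disk := mem_disk.2 (hz.trans_lt (mem_disk.1 hζ))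
  set c := p ζ with hc
  have hc0 : c ≠ 0 := fun h => hζ0 (hp.eq_zero hζ h)
  have hcc : 0 < normSq c := normSq_pos.2 hc0
  have hle : ∀ x, ‖x‖ ≤ ‖ζ‖ →
      ((starRingEnd ℂ) c * K x).re ≤ ((starRingEnd ℂ) c * K ζ).re := by
    intro x hx
    have h1 := hp.re_conj_mul_le hK hK hζ (η := x / ζ)
      (by rw [norm_div]; exact div_le_one_of_le₀ hx (norm_nonneg _))
    rwa [div_mul_cancel₀ _ hζ0] at h1
  refine lt_of_le_of_ne (hle z hz) fun heq => ?_
  have hmax : ∀ x, ‖x‖ ≤ ‖ζ‖ → ((starRingEnd ℂ) c * K x).re ≤ ((starRingEnd ℂ) c * K z).re :=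
    fun x hx => (hle x hx).trans_eq heq.symm
  -- Times `t < 0` suffice, so that `v = z` is admissible even when `z` lies on the circle: the
  -- motion is then inward.
  have hdir : ∀ v : ℂ, (∀ t ∈ Ioo (-1 : ℝ) 0, ‖z + t * v‖ ≤ ‖ζ‖) →
      0 ≤ ((starRingEnd ℂ) c * (deriv K z * v)).re := by
    intro v hv
    have h1 : HasDerivAt (fun t : ℝ => z + t * v) v 0 := by
      simpa using (((hasDerivAt_id (0 : ℝ)).ofReal_comp.mul_const v).const_add z)
    have h2 : HasDerivAt K (deriv K z) (z + ((0 : ℝ) : ℂ) * v) := by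
      simpa using hK.hasDerivAt hzd
    refine nonneg_of_hasDerivAt_of_le
      (hasDerivAt_re ((h2.comp (0 : ℝ) h1).const_mul ((starRingEnd ℂ) c)))
      (show (-1 : ℝ) < 0 by norm_num) fun t ht => ?_
    simpa using hmax _ (hv t ht)
  rcases hz.lt_or_eq with hlt | heqn
  -- Interior case: `v` is chosen so that `d * v = -δ ‖d‖²` is negative, with `δ` small enough to
  -- keep `z + t v` inside the circle.
  · set d := (starRingEnd ℂ) c * deriv K z with hd
    have hd0 : d ≠ 0 := mul_ne_zero ((map_ne_zero _).2 hc0) (hp.deriv_ne_zero hK hzd)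
    have hdn : 0 < ‖d‖ := norm_pos_iff.2 hd0
    set δ : ℝ := (‖ζ‖ - ‖z‖) / ‖d‖ with hδ
    have hδ0 : 0 < δ := div_pos (sub_pos.2 hlt) hdn
    have h1 := hdir (-(δ * (starRingEnd ℂ) d)) fun t ht => by
      have h2 : ‖(t : ℂ) * -(δ * (starRingEnd ℂ) d)‖ ≤ ‖ζ‖ - ‖z‖ := by
        rw [norm_mul, norm_neg, norm_mul, Complex.norm_conj, Complex.norm_real, Complex.norm_real,
          Real.norm_of_nonneg hδ0.le, hδ, div_mul_cancel₀ _ hdn.ne', Real.norm_eq_abs]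
        have : |t| ≤ 1 := abs_le.2 ⟨ht.1.le, by linarith [ht.2]⟩
        nlinarith
      linarith [norm_add_le z ((t : ℂ) * -(δ * (starRingEnd ℂ) d))]
    have h3 : (starRingEnd ℂ) c * (deriv K z * -(δ * (starRingEnd ℂ) d))
        = ((-(δ * normSq d) : ℝ) : ℂ) := by
      push_cast
      rw [normSq_eq_conj_mul_self, hd]
      ring
    rw [h3, Complex.ofReal_re] at h1
    have := mul_pos hδ0 (normSq_pos.2 hd0)
    linarith
  -- Circle case: the tangential and radial derivatives make `p z` a positive multiple of `p ζ`.
  -- Points on the same ray of the image have preimages of different modulus unless they coincide.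
  · have him : ((starRingEnd ℂ) c * (z * deriv K z)).im = 0 :=
      im_eq_zero_of_isMax_circle (hK.hasDerivAt hzd) fun t =>
        hmax _ (by rw [norm_mul, Complex.norm_exp_ofReal_mul_I, mul_one]; exact hz)
    have hre : 0 ≤ ((starRingEnd ℂ) c * (z * deriv K z)).re := by
      rw [mul_comm z]
      refine hdir z fun t ht => ?_
      have h1 : z + t * z = ((1 + t : ℝ) : ℂ) * z := by push_cast; ring
      rw [h1, norm_mul, Complex.norm_real, Real.norm_of_nonneg (by linarith [ht.1])]
      nlinarith [norm_nonneg z, ht.2]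
    have hz0 : z ≠ 0 := norm_ne_zero_iff.1 (by rw [heqn]; exact norm_ne_zero_iff.2 hζ0)
    rw [hK.mul_deriv z hzd, id] at him hre
    set m := ((starRingEnd ℂ) c * p z).re with hm
    have hmeq : (starRingEnd ℂ) c * p z = m := by apply Complex.ext <;> simp [hm, him]
    have hpz : (m : ℂ) * c = normSq c * p z := by
      rw [← hmeq, normSq_eq_conj_mul_self]
      ring
    have hcc' : (normSq c : ℂ) ≠ 0 := Complex.ofReal_ne_zero.2 hcc.ne'
    have hm0 : 0 < m := by
      refine lt_of_le_of_ne hre fun h => hz0 (hp.eq_zero hzd ?_)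
      rw [← h, Complex.ofReal_zero, zero_mul] at hpz
      exact (mul_eq_zero.1 hpz.symm).resolve_left hcc'
    have hm0' : (m : ℂ) ≠ 0 := Complex.ofReal_ne_zero.2 hm0.ne'
    rcases lt_trichotomy m (normSq c) with h | h | h
    · have := hp.norm_lt_of_eq_mul (s := m / normSq c) ⟨by positivity, (div_lt_one hcc).2 h⟩
        hzd hζ hζ0 (by push_cast; rw [div_mul_eq_mul_div, eq_div_iff hcc', ← hc]; linear_combination -hpz)
      exact this.ne heqn
    · rw [h] at hpz
      exact hne (hp.univalent hzd hζ (mul_left_cancel₀ hcc' hpz).symm)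
    · have := hp.norm_lt_of_eq_mul (s := normSq c / m) ⟨by positivity, (div_lt_one hm0).2 h⟩
        hζ hzd hz0 (by push_cast; rw [div_mul_eq_mul_div, eq_div_iff hm0', ← hc]; linear_combination hpz)
      exact this.ne heqn.symm

/-! ### Univalence of `K` and subordination to it. -/

theorem IsStarlike.injOn_primitive {p K : ℂ → ℂ} (hp : IsStarlike p)
    (hK : IsEulerPrimitive p id K) : InjOn K disk := by
  intro x hx y hy h
  by_contra hne
  rcases le_total ‖x‖ ‖y‖ with hxy | hxy
  · have := hp.re_conj_mul_lt hK hy hxy hne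
    rw [h] at this
    exact lt_irrefl _ this
  · have := hp.re_conj_mul_lt hK hx hxy (Ne.symm hne)
    rw [h] at this
    exact lt_irrefl _ this

/-- The segment from `0` to `L z` is followed to its last point in the compact image. That point
cannot come from the open disk, by openness of `K`, nor from the circle before `L z` is reached, by
the supporting line there. -/
theorem IsStarlike.mem_image_closedBall {p w K L : ℂ → ℂ} (hp : IsStarlike p)
    (hK : IsEulerPrimitive p id K) (hL : IsEulerPrimitive p w L) {z : ℂ} (hz : z ∈ disk) :
    L z ∈ K '' Metric.closedBall 0 ‖z‖ := by
  have hsub : Metric.closedBall (0 : ℂ) ‖z‖ ⊆ disk :=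
    Metric.closedBall_subset_ball (mem_disk.1 hz)
  have hcomp : IsCompact (K '' Metric.closedBall 0 ‖z‖) :=
    (isCompact_closedBall _ _).image_of_continuousOn (hK.analytic.continuousOn.mono hsub)
  set T : Set ℝ := Icc 0 1 ∩ (fun t : ℝ => (t : ℂ) * L z) ⁻¹' (K '' Metric.closedBall 0 ‖z‖)
  have hT : IsCompact T := isCompact_Icc.inter_right
    (hcomp.isClosed.preimage (Complex.continuous_ofReal.mul continuous_const))
  have hT0 : (0 : ℝ) ∈ T := ⟨by simp, 0, by simp, by simp [hK.map_zero]⟩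
  obtain ⟨t, ht, htmax⟩ := hT.exists_isGreatest ⟨0, hT0⟩
  obtain ⟨ζ, hζ, hζt⟩ := ht.2
  have hζd := hsub hζ
  rcases ht.1.2.eq_or_lt with h1 | h1
  · exact ⟨ζ, hζ, by simpa [h1] using hζt⟩
  exfalso
  rcases (mem_closedBall_zero_iff.1 hζ).lt_or_eq with hlt | heq
  · have hopen : K '' Metric.closedBall 0 ‖z‖ ∈ 𝓝 ((t : ℂ) * L z) := by
      have h2 := nhds_le_map_of_injOn isOpen_disk hK.analytic (hp.injOn_primitive hK) hζd
      simp only at hζt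
      rw [hζt] at h2
      exact h2 (image_mem_map (mem_of_superset
        (Metric.isOpen_ball.mem_nhds (mem_ball_zero_iff.2 hlt)) Metric.ball_subset_closedBall))
    have hc : ContinuousAt (fun t : ℝ => (t : ℂ) * L z) t :=
      (Complex.continuous_ofReal.mul continuous_const).continuousAt
    have hev : ∀ᶠ s in 𝓝[>] t, s ∈ T := by
      filter_upwards [nhdsWithin_le_nhds (hc.preimage_mem_nhds hopen), Ioo_mem_nhdsGT h1]
        with s hs hs'
      exact ⟨⟨ht.1.1.trans hs'.1.le, hs'.2.le⟩, hs⟩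
    obtain ⟨s, hs, hst⟩ := (hev.and self_mem_nhdsWithin).exists
    exact absurd (htmax hs) (not_le.2 hst)
  · rcases eq_or_ne z 0 with rfl | hz0
    · exact absurd (htmax (⟨by simp, 0, by simp, by simp [hK.map_zero, hL.map_zero]⟩ : (1 : ℝ) ∈ T))
        (not_le.2 h1)
    have hζ0 : ζ ≠ 0 := norm_ne_zero_iff.1 (by rw [heq]; exact norm_ne_zero_iff.2 hz0)
    have h2 := hp.re_conj_mul_le hK hL hζd (η := z / ζ)
      (by rw [norm_div, heq]; exact div_self_le_one _)
    rw [div_mul_cancel₀ _ hζ0] at h2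
    -- Comparison with `K 0 = 0` shows that the functional is positive at `K ζ = t * L z`; being
    -- larger at `L z` when `t < 1`, it violates `h2`.
    have h3 := hp.re_conj_mul_lt hK hζd (z := 0) (by simp) hζ0.symm
    have h4 : (starRingEnd ℂ) (p ζ) * K ζ = t * ((starRingEnd ℂ) (p ζ) * L z) := by
      rw [hζt]
      ring
    rw [hK.map_zero, mul_zero, zero_re, h4, re_ofReal_mul] at h3
    rw [h4, re_ofReal_mul] at h2
    nlinarith [ht.1.1]

/-- Subordination: `L = K ∘ ω` for a Schwarz function `ω`. -/
theorem IsStarlike.exists_schwarz {p w K L : ℂ → ℂ} (hp : IsStarlike p)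
    (hK : IsEulerPrimitive p id K) (hL : IsEulerPrimitive p w L) :
    ∃ ω, IsSchwarz ω ∧ ∀ z ∈ disk, L z = K (ω z) := by
  have hinj := hp.injOn_primitive hK
  have hmem : ∀ z ∈ disk, ∃ a ∈ disk, K a = L z := fun z hz => by
    obtain ⟨a, ha, h⟩ := hp.mem_image_closedBall hK hL hz
    exact ⟨a, Metric.closedBall_subset_ball (mem_disk.1 hz) ha, h⟩
  refine ⟨fun z => Function.invFunOn K disk (L z), ⟨fun z hz => ?_, fun z hz => ?_, ?_⟩,
    fun z hz => ?_⟩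
  · obtain ⟨a, ha, h⟩ := hmem z hz
    have h1 := hasDerivAt_invFunOn isOpen_disk hK.analytic hinj ha
    rw [h] at h1
    exact (h1.comp z (hL.hasDerivAt hz)).differentiableAt.differentiableWithinAt
  · exact Function.invFunOn_mem (hmem z hz)
  · simp only [hL.map_zero]
    have h1 := invFunOn_apply hinj zero_mem_disk
    rwa [hK.map_zero] at h1
  · exact (Function.invFunOn_eq (hmem z hz)).symm

/-! ### The integral `K`, membership in the class, and the extremal functions. -/

theorem IsStarlike.exists_primitive {p : ℂ → ℂ} (hp : IsStarlike p) :
    ∃ K, IsEulerPrimitive p id K ∧ ∀ b ∈ disk, segIntegral (fun t => p t / t) b = K b := by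
  have hg : DifferentiableOn ℂ (dslope p 0) disk :=
    (differentiableOn_dslope (isOpen_disk.mem_nhds zero_mem_disk)).2 hp.analytic
  obtain ⟨K, hK0, hK⟩ := hg.isExactOn_ball.with_val_at 0 0
  have hdiv : ∀ z, z ≠ 0 → dslope p 0 z = p z / z := fun z hz => by
    rw [dslope_of_ne _ hz, slope_def_field, hp.map_zero, sub_zero, sub_zero]
  refine ⟨K, ⟨⟨differentiableOn_id, mapsTo_id _, rfl⟩,
    fun z hz => (hK z hz).differentiableAt.differentiableWithinAt, hK0, fun z hz => ?_⟩,
    fun b hb => ?_⟩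
  · rw [(hK z hz).deriv, id]
    rcases eq_or_ne z 0 with rfl | hz0
    · rw [zero_mul, hp.map_zero]
    · rw [hdiv z hz0, mul_div_cancel₀ _ hz0]
  · have hmem : ∀ s ∈ uIcc (0 : ℝ) 1, (s : ℂ) * b ∈ disk := fun s hs => by
      rw [uIcc_of_le zero_le_one] at hs
      refine (isSchwarz_mul ?_).mapsTo hb
      rw [Complex.norm_real, Real.norm_of_nonneg hs.1]
      exact hs.2
    have hd : ∀ s ∈ uIcc (0 : ℝ) 1,
        HasDerivAt (fun s : ℝ => K (s * b)) (dslope p 0 (s * b) * b) s := fun s hs => by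
      have h2 : HasDerivAt (fun t : ℝ => (t : ℂ) * b) b s := by
        simpa using (hasDerivAt_id s).ofReal_comp.mul_const b
      exact (hK _ (hmem s hs)).comp s h2
    have hcont : ContinuousOn (fun s : ℝ => dslope p 0 (s * b) * b) (uIcc 0 1) :=
      (hg.continuousOn.comp (Complex.continuous_ofReal.mul continuous_const).continuousOn
        hmem).mul continuousOn_const
    have hint := intervalIntegral.integral_eq_sub_of_hasDerivAt hd hcont.intervalIntegrable
    simp only [Complex.ofReal_one, one_mul, Complex.ofReal_zero, zero_mul, hK0, sub_zero] at hint
    rw [segIntegral, ← hint]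
    -- `p t / t` is `0` at `t = 0` by convention and may differ there from `dslope p 0`; the
    -- half-open interval omits `s = 0`.
    refine intervalIntegral.integral_congr_ae (Eventually.of_forall fun s hs => ?_)
    rw [uIoc_of_le zero_le_one] at hs
    rcases eq_or_ne b 0 with rfl | hb0
    · simp
    · rw [hdiv _ (mul_ne_zero (Complex.ofReal_ne_zero.2 hs.1.ne') hb0)]

/-- Logarithmic differentiation of `f = z exp L` gives `z f' / f = 1 + z L'`. -/
theorem isEulerPrimitive_of_mem {ψ f : ℂ → ℂ} (hf : f ∈ starClass ψ) {L : ℂ → ℂ}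
    (hL : IsLogRatio f L) : ∃ w, IsEulerPrimitive (fun z => ψ z - 1) w L := by
  obtain ⟨-, h0, w, hw, hmaps, hw0, hsub⟩ := hf
  refine ⟨w, ⟨hw, hmaps, hw0⟩, hL.analytic, hL.map_zero, fun z hz => ?_⟩
  rw [← hsub z hz, starQuot]
  split_ifs with hz0
  · simp [hz0]
  · have hLd := ((hL.analytic z hz).differentiableAt (isOpen_disk.mem_nhds hz)).hasDerivAt
    have hfd : HasDerivAt f (1 * exp (L z) + z * (exp (L z) * deriv L z)) z := by
      refine ((hasDerivAt_id z).mul hLd.cexp).congr_of_eventuallyEq ?_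
      filter_upwards [isOpen_disk.mem_nhds hz] with x hx
      exact hL.eq_exp x hx
    have hfz := h0 z hz hz0
    rw [hfd.deriv, eq_sub_iff_add_eq, eq_div_iff hfz, hL.eq_exp z hz]
    ring

theorem isLogRatio_extremal {ψ K : ℂ → ℂ} (hK : IsEulerPrimitive (fun z => ψ z - 1) id K)
    (hseg : ∀ b ∈ disk, segIntegral (fun t => (ψ t - 1) / t) b = K b) {ζ : ℂ} (hζ : ‖ζ‖ = 1) :
    IsLogRatio (extremal ψ ζ) (fun z => K (ζ * z)) where
  analytic := hK.analytic.comp (isSchwarz_mul hζ.le).analytic (isSchwarz_mul hζ.le).mapsTo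
  map_zero := by simp [hK.map_zero]
  eq_exp := fun z hz => by rw [extremal, hseg _ ((isSchwarz_mul hζ.le).mapsTo hz)]

theorem extremal_mem_starClass {ψ K : ℂ → ℂ} (hψ : ψ 0 = 1)
    (hK : IsEulerPrimitive (fun z => ψ z - 1) id K)
    (hseg : ∀ b ∈ disk, segIntegral (fun t => (ψ t - 1) / t) b = K b) {ζ : ℂ} (hζ : ‖ζ‖ = 1) :
    extremal ψ ζ ∈ starClass ψ := by
  have hL := isLogRatio_extremal hK hseg hζ
  have hS := isSchwarz_mul hζ.le
  have hd : ∀ z ∈ disk, HasDerivAt (extremal ψ ζ)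
      (1 * exp (K (ζ * z)) + z * (exp (K (ζ * z)) * (deriv K (ζ * z) * (ζ * 1)))) z := by
    intro z hz
    have h1 : HasDerivAt (fun z => K (ζ * z)) (deriv K (ζ * z) * (ζ * 1)) z :=
      (hK.hasDerivAt (hS.mapsTo hz)).comp z ((hasDerivAt_id z).const_mul ζ)
    refine ((hasDerivAt_id z).mul h1.cexp).congr_of_eventuallyEq ?_
    filter_upwards [isOpen_disk.mem_nhds hz] with x hx
    exact hL.eq_exp x hx
  refine ⟨⟨fun z hz => (hd z hz).differentiableAt.differentiableWithinAt, by simp [extremal], ?_⟩,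
    fun z hz hz0 => ?_, _, hS.analytic, hS.mapsTo, hS.map_zero, fun z hz => ?_⟩
  · rw [(hd 0 zero_mem_disk).deriv]
    simp [hK.map_zero]
  · rw [hL.eq_exp z hz]
    exact mul_ne_zero hz0 (exp_ne_zero _)
  · rw [starQuot]
    split_ifs with hz0
    · simp [hz0, hψ]
    · have h1 := hK.mul_deriv _ (hS.mapsTo hz)
      simp only [id] at h1
      rw [(hd z hz).deriv, hL.eq_exp z hz, div_eq_iff (mul_ne_zero hz0 (exp_ne_zero _))]
      linear_combination z * exp (K (ζ * z)) * h1

/-! ### The maximum principle and the extremal problem. -/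

/-- A nonconstant entire function composed with a univalent one has no interior maximum modulus
on a disk. -/
theorem norm_eq_of_isMaxOn_closedBall {Φ K : ℂ → ℂ} (hΦ : Differentiable ℂ Φ)
    (hΦc : ¬ ∃ c : ℂ, ∀ z : ℂ, Φ z = c) (hK : DifferentiableOn ℂ K disk) (hinj : InjOn K disk)
    {r : ℝ} (hr : r < 1) {a : ℂ} (ha : ‖a‖ ≤ r)
    (hmax : ∀ x, ‖x‖ ≤ r → ‖Φ (K x)‖ ≤ ‖Φ (K a)‖) : ‖a‖ = r := by
  by_contra hne
  have hlt : ‖a‖ < r := lt_of_le_of_ne ha hne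
  have hamem : a ∈ Metric.ball (0 : ℂ) r := mem_ball_zero_iff.2 hlt
  have hsub : Metric.ball (0 : ℂ) r ⊆ disk := Metric.ball_subset_ball hr.le
  have hconst := Complex.eqOn_of_isPreconnected_of_isMaxOn_norm (f := fun x => Φ (K x))
    (convex_ball (0 : ℂ) r).isPreconnected Metric.isOpen_ball
    (hΦ.comp_differentiableOn (hK.mono hsub)) hamem
    (fun x hx => hmax x (mem_ball_zero_iff.1 hx).le)
  refine hΦc ⟨Φ (K a), fun z => ?_⟩
  -- Constancy of `Φ ∘ K` near `a` passes to `Φ` near `K a` because `K` is open; the identity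
  -- theorem then makes `Φ` constant.
  have hev : Φ =ᶠ[𝓝 (K a)] fun _ => Φ (K a) := by
    refine nhds_le_map_of_injOn isOpen_disk hK hinj (hsub hamem) (eventually_map.2 ?_)
    filter_upwards [Metric.isOpen_ball.mem_nhds hamem] with x hx
    exact hconst hx
  have hΦa : AnalyticOnNhd ℂ Φ univ := fun x _ => hΦ.analyticAt x
  exact hΦa.eqOn_of_preconnected_of_eventuallyEq analyticOnNhd_const isPreconnected_univ
    (mem_univ _) hev (mem_univ z)

theorem exists_max_norm_and_eq_extremal {ψ : ℂ → ℂ} (hψ : IsMaMinda ψ) {Φ : ℂ → ℂ}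
    (hΦ : Differentiable ℂ Φ) (hΦc : ¬ ∃ c : ℂ, ∀ z : ℂ, Φ z = c) {z₀ : ℂ} (hz₀ : 0 < ‖z₀‖)
    (hz₀' : ‖z₀‖ < 1) :
    (∃ f ∈ starClass ψ, IsMaxOn (fun g : ℂ → ℂ => ‖Φ (logRatio g z₀)‖) (starClass ψ) f) ∧
      ∀ f ∈ starClass ψ, IsMaxOn (fun g : ℂ → ℂ => ‖Φ (logRatio g z₀)‖) (starClass ψ) f →
        ∃ ζ : ℂ, ‖ζ‖ = 1 ∧ EqOn f (extremal ψ ζ) disk := by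
  have hp := hψ.isStarlike
  have hz₀d : z₀ ∈ disk := mem_disk.2 hz₀'
  have hz₀0 : z₀ ≠ 0 := norm_pos_iff.1 hz₀
  obtain ⟨K, hK, hseg⟩ := hp.exists_primitive
  have hinj := hp.injOn_primitive hK
  have hsub : Metric.closedBall (0 : ℂ) ‖z₀‖ ⊆ disk := Metric.closedBall_subset_ball hz₀'
  have hrep : ∀ f ∈ starClass ψ, ∃ ω, IsSchwarz ω ∧ ∀ z ∈ disk, logRatio f z = K (ω z) :=
    fun f hf => by
      obtain ⟨w, hw⟩ := isEulerPrimitive_of_mem hf (isLogRatio_logRatio hf)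
      exact hp.exists_schwarz hK hw
  have hext : ∀ ζ : ℂ, ‖ζ‖ = 1 → extremal ψ ζ ∈ starClass ψ := fun ζ hζ =>
    extremal_mem_starClass hψ.map_zero hK hseg hζ
  have hextlog : ∀ ζ : ℂ, ‖ζ‖ = 1 → logRatio (extremal ψ ζ) z₀ = K (ζ * z₀) := fun ζ hζ =>
    (isLogRatio_logRatio (hext ζ hζ)).eqOn (isLogRatio_extremal hK hseg hζ) hz₀d
  have hcont : ContinuousOn (fun x => ‖Φ (K x)‖) (Metric.closedBall 0 ‖z₀‖) :=
    (hΦ.continuous.comp_continuousOn (hK.analytic.continuousOn.mono hsub)).norm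
  obtain ⟨a, ha, hamax⟩ := (isCompact_closedBall (0 : ℂ) ‖z₀‖).exists_isMaxOn
    ⟨0, by simp⟩ hcont
  have hamax' : ∀ x, ‖x‖ ≤ ‖z₀‖ → ‖Φ (K x)‖ ≤ ‖Φ (K a)‖ := fun x hx =>
    hamax (mem_closedBall_zero_iff.2 hx)
  have hanorm := norm_eq_of_isMaxOn_closedBall hΦ hΦc hK.analytic hinj hz₀'
    (mem_closedBall_zero_iff.1 ha) hamax'
  have hζ : ‖a / z₀‖ = 1 := by rw [norm_div, hanorm, div_self hz₀.ne']
  have hval : logRatio (extremal ψ (a / z₀)) z₀ = K a := by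
    rw [hextlog _ hζ, div_mul_cancel₀ _ hz₀0]
  refine ⟨⟨extremal ψ (a / z₀), hext _ hζ, fun g hg => ?_⟩, fun f hf hfmax => ?_⟩
  · obtain ⟨ω, hω, hgω⟩ := hrep g hg
    change ‖Φ (logRatio g z₀)‖ ≤ ‖Φ (logRatio (extremal ψ (a / z₀)) z₀)‖
    rw [hval, hgω z₀ hz₀d]
    exact hamax' _ (hω.norm_le hz₀d)
  · obtain ⟨ω, hω, hfω⟩ := hrep f hf
    have h1 : ‖Φ (logRatio (extremal ψ (a / z₀)) z₀)‖ ≤ ‖Φ (logRatio f z₀)‖ :=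
      hfmax (hext _ hζ)
    rw [hval, hfω z₀ hz₀d] at h1
    -- Maximality of `f` makes `ω z₀` a maximum point of `‖Φ ∘ K‖` on the closed disk, hence a point
    -- of the circle.
    have h2 := norm_eq_of_isMaxOn_closedBall hΦ hΦc hK.analytic hinj hz₀' (hω.norm_le hz₀d)
      fun x hx => (hamax' x hx).trans h1
    obtain ⟨η, hη, hrot⟩ := hω.exists_rotation hz₀d hz₀0 h2
    refine ⟨η, hη, fun z hz => ?_⟩
    rw [(isLogRatio_logRatio hf).eq_exp z hz, (isLogRatio_extremal hK hseg hη).eq_exp z hz,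
      hfω z hz, hrot z hz]

theorem exp_comp_not_const {Φ : ℂ → ℂ} (hΦ : Differentiable ℂ Φ)
    (hΦc : ¬ ∃ c : ℂ, ∀ z : ℂ, Φ z = c) : ¬ ∃ c : ℂ, ∀ z : ℂ, exp (Φ z) = c := by
  rintro ⟨c, hc⟩
  refine hΦc ⟨Φ 0, fun z => is_const_of_deriv_eq_zero hΦ (fun x => ?_) z 0⟩
  have h1 := (hΦ x).hasDerivAt.cexp
  have h2 : HasDerivAt (fun z => exp (Φ z)) 0 x := by
    rw [funext hc]
    exact hasDerivAt_const x c
  exact (mul_eq_zero.1 (h1.unique h2)).resolve_left (exp_ne_zero _)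

theorem isMaxOn_norm_exp_iff {α : Type*} {F : α → ℂ} {s : Set α} {a : α} :
    IsMaxOn (fun x => ‖exp (F x)‖) s a ↔ IsMaxOn (fun x => (F x).re) s a := by
  simp only [isMaxOn_iff, Complex.norm_exp, Real.exp_le_exp]

end MaMinda

end

theorem theorem3 (ψ : ℂ → ℂ) (hψ : MaMinda.IsMaMinda ψ)
    (hclosed : MaMinda.ClosedOnDisk (MaMinda.starClass ψ))
    (Φ : ℂ → ℂ) (hΦ : Differentiable ℂ Φ) (hΦ_nonconst : ¬ ∃ c : ℂ, ∀ z : ℂ, Φ z = c)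
    (z₀ : ℂ) (hz₀_pos : 0 < ‖z₀‖) (hz₀_lt : ‖z₀‖ < 1) :
    ((∃ f ∈ MaMinda.starClass ψ,
        IsMaxOn (fun g : ℂ → ℂ => (Φ (MaMinda.logRatio g z₀)).re) (MaMinda.starClass ψ) f) ∧
      ∀ f ∈ MaMinda.starClass ψ,
        IsMaxOn (fun g : ℂ → ℂ => (Φ (MaMinda.logRatio g z₀)).re) (MaMinda.starClass ψ) f →
        ∃ ζ : ℂ, ‖ζ‖ = 1 ∧ Set.EqOn f (MaMinda.extremal ψ ζ) MaMinda.disk) ∧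
    ((∃ f ∈ MaMinda.starClass ψ,
        IsMaxOn (fun g : ℂ → ℂ => ‖Φ (MaMinda.logRatio g z₀)‖) (MaMinda.starClass ψ) f) ∧
      ∀ f ∈ MaMinda.starClass ψ,
        IsMaxOn (fun g : ℂ → ℂ => ‖Φ (MaMinda.logRatio g z₀)‖) (MaMinda.starClass ψ) f →
        ∃ ζ : ℂ, ‖ζ‖ = 1 ∧ Set.EqOn f (MaMinda.extremal ψ ζ) MaMinda.disk) := by
  refine ⟨?_, MaMinda.exists_max_norm_and_eq_extremal hψ hΦ hΦ_nonconst hz₀_pos hz₀_lt⟩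
  -- Since `‖exp (Φ u)‖ = exp (Re (Φ u))`, the maxima of the real part are those of the modulus for
  -- `exp ∘ Φ`.
  have h := MaMinda.exists_max_norm_and_eq_extremal hψ hΦ.cexp
    (MaMinda.exp_comp_not_const hΦ hΦ_nonconst) hz₀_pos hz₀_lt
  simpa only [MaMinda.isMaxOn_norm_exp_iff] using h
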